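/- For a permutation $\sigma=\sigma_1\cdots\sigma_n\in S_n$ let $\mathrm{des}(\sigma)=|\{1\le i<n:\sigma_i>\sigma_{i+1}\}|$ and $\mathrm{ris}(\sigma)=|\{1\le i<n:\sigma_i<\sigma_{i+1}\}|$. A sequence $(a_k)_{k\ge 0}$ of polynomials in $\mathbb{R}[p,q]$ is called a *Stieltjes moment sequence of polynomials* if its infinite Hankel matrix $[a_{i+j}]_{i,j\ge 0}$ is $(p,q)$-totally positive, that is, if for every $r\ge 1$ and all row indices $0\le i_1<\cdots<i_r$ and column indices $0\le j_1<\cdots<j_r$, the minor $\det[a_{i_s+j_t}]_{1\le s,t\le r}$ is a polynomial in $p,q$ all of whose coefficients are nonnegative. **Proposition.** The sequence of bivariate Eulerian polynomials $$\Big(\sum_{\sigma\in S_n}p^{\mathrm{ris}(\sigma)}q^{\mathrm{des}(\sigma)}\Big)_{n\ge 1}$$ is a Stieltjes moment sequence of polynomials. In other words, $(a_k)_{k\ge0}$ with $a_k=\sum_{\sigma\in S_{k+1}}p^{\mathrm{ris}(\sigma)}q^{\mathrm{des}(\sigma)}$ is a Stieltjes moment sequence of polynomials. -/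

import Mathlib

namespace StieltjesPoly

/-- A real polynomial is `x`-nonnegative when all of its coefficients are nonnegative. -/
def CoeffNonneg {ι : Type*} (f : MvPolynomial ι ℝ) : Prop :=
  ∀ d : ι →₀ ℕ, 0 ≤ MvPolynomial.coeff d f

/-- A matrix of polynomials is `x`-totally positive of order `r` when all its minors of order
`1, ..., r` (with rows and columns taken in increasing order) are `x`-nonnegative. -/
def IsTotallyPositiveOfOrder {ι m n : Type*} [LinearOrder m] [LinearOrder n] (r : ℕ)
    (M : Matrix m n (MvPolynomial ι ℝ)) : Prop :=
  ∀ k : ℕ, 1 ≤ k → k ≤ r → ∀ (rows : Fin k → m) (cols : Fin k → n),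
    StrictMono rows → StrictMono cols → CoeffNonneg (M.submatrix rows cols).det

/-- A matrix of polynomials is `x`-totally positive when it is so of every order `r ≥ 1`. -/
def IsTotallyPositive {ι m n : Type*} [LinearOrder m] [LinearOrder n]
    (M : Matrix m n (MvPolynomial ι ℝ)) : Prop :=
  ∀ r : ℕ, 1 ≤ r → IsTotallyPositiveOfOrder r M

/-- The infinite Hankel matrix `[a (i + j)]` of a sequence. -/
def hankel {R : Type*} (a : ℕ → R) : Matrix ℕ ℕ R :=
  Matrix.of fun i j => a (i + j)

/-- A sequence of polynomials is a Stieltjes moment sequence of polynomials when its Hankel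
matrix is `x`-totally positive. -/
def IsStieltjesMomentSequence {ι : Type*} (a : ℕ → MvPolynomial ι ℝ) : Prop :=
  IsTotallyPositive (hankel a)

/-- The number of descents `σ i > σ (i + 1)` of a permutation. -/
def des {n : ℕ} (σ : Equiv.Perm (Fin n)) : ℕ :=
  (Finset.univ.filter fun i : Fin n => ∃ h : i.val + 1 < n, σ ⟨i.val + 1, h⟩ < σ i).card

/-- The number of rises `σ i < σ (i + 1)` of a permutation. -/
def ris {n : ℕ} (σ : Equiv.Perm (Fin n)) : ℕ :=
  (Finset.univ.filter fun i : Fin n => ∃ h : i.val + 1 < n, σ i < σ ⟨i.val + 1, h⟩).card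

/-- The bivariate Eulerian polynomial `∑ p ^ ris σ * q ^ des σ` over the permutations of `n`
letters, where `p` is the variable `X 0` and `q` is the variable `X 1`. -/
noncomputable def eulerianPoly (n : ℕ) : MvPolynomial (Fin 2) ℝ :=
  ∑ σ : Equiv.Perm (Fin n), MvPolynomial.X 0 ^ ris σ * MvPolynomial.X 1 ^ des σ

end StieltjesPoly

/-!
The proof factors the Hankel matrix `H` of the polynomials `A 1, A 2, …`, where `A n` is
`eulerianPoly n`, into matrices whose minors visibly have nonnegative coefficients.

Inserting the largest letter into a permutation in all possible ways gives the recurrence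
`A (n + 2) = (p + q) A (n + 1) + p q δ (A (n + 1))` with `δ = ∂/∂p + ∂/∂q`
(`eulerianPoly_add_two`). Since `δ (p + q) = 2` and `δ (p q) = p + q`, applying `δ ^ k` to it shows
that the polynomials `S n k = δ ^ k (A (n + 1)) / (k! (k + 1)!)` satisfy the tridiagonal recurrence
`S (n + 1) k = S n (k - 1) + (k + 1) (p + q) S n k + (k + 1) (k + 2) p q S n (k + 1)`. This is the
recurrence that defines `stieltjesMatrix`, and so column `0` of that matrix consists of the
polynomials `A (n + 1)` (`factorial_mul_stieltjesMatrix`).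

The tridiagonal matrix is symmetric for the weights `w k = k! (k + 1)! (p q) ^ k`, and therefore
`H = S W Sᵀ` with `W` the diagonal matrix of the weights (`eulerianPoly_add_eq_sum`). By the
Cauchy–Binet formula (`factorial_mul_det_mul`) it is enough that `S` is totally positive. The
tridiagonal matrix, bordered by the first row of the identity, is the product of two lower
bidiagonal matrices with entries `1` on the diagonal and `(k + 1) p`, respectively `(k + 1) q`,
below it. Hence `S = (1 ⊕ S) L L'` with `L` and `L'` these two matrices
(`stieltjesMatrix_eq_borderOne`). Bidiagonal matrices with nonnegative entries are totally positive
(`isTotallyPositive_lowerBidiagonal`), and the minors of `1 ⊕ S` in the rows below `N + 1` are zero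
or minors of `S` in the rows below `N`, so total positivity follows by induction on `N`
(`isTotallyPositive_stieltjesMatrix`).
-/

namespace StieltjesPoly

open MvPolynomial Finset

/-! ### Polynomials with nonnegative coefficients -/

/-- The polynomials with nonnegative coefficients, as a subsemiring. -/
def coeffNonnegSubsemiring (ι : Type*) : Subsemiring (MvPolynomial ι ℝ) where
  carrier := {f | CoeffNonneg f}
  zero_mem' d := by simp
  one_mem' d := by
    classical
    rw [coeff_one]
    split_ifs <;> norm_num
  add_mem' hf hg d := by
    rw [coeff_add]
    exact add_nonneg (hf d) (hg d)
  mul_mem' hf hg d := by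
    classical
    rw [coeff_mul]
    exact sum_nonneg fun x _ => mul_nonneg (hf x.1) (hg x.2)

section CoeffNonneg

variable {ι : Type*}

theorem mem_coeffNonnegSubsemiring {f : MvPolynomial ι ℝ} :
    f ∈ coeffNonnegSubsemiring ι ↔ CoeffNonneg f :=
  Iff.rfl

theorem coeffNonneg_X (i : ι) : CoeffNonneg (X i) := by
  classical
  intro d
  rw [coeff_X]
  split_ifs <;> norm_num

theorem CoeffNonneg.of_natCast_mul {n : ℕ} (hn : n ≠ 0) {f : MvPolynomial ι ℝ}
    (h : CoeffNonneg ((n : MvPolynomial ι ℝ) * f)) : CoeffNonneg f := by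
  intro d
  have hd := h d
  rw [← nsmul_eq_mul, coeff_smul, nsmul_eq_mul] at hd
  exact nonneg_of_mul_nonneg_right hd (by positivity)

end CoeffNonneg

/-! ### Minors of products -/

/-- The Cauchy–Binet formula, with the sum over increasing tuples replaced by the sum over all
tuples: each increasing tuple is counted once for each of its `k!` rearrangements, and the tuples
with a repetition contribute zero. -/
theorem factorial_mul_det_mul {R κ : Type*} [CommRing R] [Fintype κ] {k : ℕ}
    (A : Matrix (Fin k) κ R) (B : Matrix κ (Fin k) R) :
    (k.factorial : R) * (A * B).det =
      ∑ f : Fin k → κ, (A.submatrix id f).det * (B.submatrix f id).det := by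
  classical
  have expand : ∀ A' : Matrix (Fin k) κ R, (A' * B).det =
      ∑ f : Fin k → κ, (∏ i, A' i (f i)) * (B.submatrix f id).det := by
    intro A'
    have hrow : A' * B = fun i => ∑ l, A' i l • B l := by
      funext i j
      simp [Matrix.mul_apply, Finset.sum_apply]
    rw [hrow]
    refine ((Matrix.detRowAlternating (n := Fin k) (R := R)).toMultilinearMap.map_sum
      (fun i l => A' i l • B l)).trans ?_
    refine sum_congr rfl fun f _ => ?_
    exact (Matrix.detRowAlternating (n := Fin k) (R := R)).toMultilinearMap.map_smul_univ _ _
  simp_rw [Matrix.det_apply' (A.submatrix id _), sum_mul]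
  rw [sum_comm]
  -- Each term `σ` of the Leibniz expansion contributes the same amount: it is the expansion of
  -- `A * B` with its rows permuted by `σ`, and the two signs cancel.
  have key : ∀ σ : Equiv.Perm (Fin k), ∑ f : Fin k → κ,
      (((Equiv.Perm.sign σ : ℤ) : R) * ∏ i, A.submatrix id f (σ i) i) *
        (B.submatrix f id).det = (A * B).det := by
    intro σ
    have h1 := expand (A.submatrix σ id)
    have h2 : A.submatrix σ id * B = (A * B).submatrix σ id := by
      ext i j
      simp [Matrix.mul_apply]
    rw [h2, Matrix.det_permute] at h1
    simp_rw [mul_assoc]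
    rw [← mul_sum]
    simp only [Matrix.submatrix_apply, id] at h1 ⊢
    rw [← h1, ← mul_assoc, ← Int.cast_mul, ← Units.val_mul, Int.units_mul_self]
    simp
  rw [sum_congr rfl fun σ _ => key σ]
  simp [Fintype.card_perm]

/-- If all maximal minors of `A` and of `B` have nonnegative coefficients, then so has the
determinant of `A * B`. -/
theorem coeffNonneg_det_mul {ι κ : Type*} [Fintype κ] [LinearOrder κ] {k : ℕ}
    {A : Matrix (Fin k) κ (MvPolynomial ι ℝ)} {B : Matrix κ (Fin k) (MvPolynomial ι ℝ)}
    (hA : ∀ g : Fin k → κ, StrictMono g → CoeffNonneg (A.submatrix id g).det)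
    (hB : ∀ g : Fin k → κ, StrictMono g → CoeffNonneg (B.submatrix g id).det) :
    CoeffNonneg (A * B).det := by
  refine CoeffNonneg.of_natCast_mul k.factorial_ne_zero ?_
  rw [factorial_mul_det_mul, ← mem_coeffNonnegSubsemiring]
  refine sum_mem fun f _ => ?_
  by_cases hf : Function.Injective f
  · set π := Tuple.sort f
    have hg : StrictMono (f ∘ π) :=
      (Tuple.monotone_sort f).strictMono_of_injective (hf.comp π.injective)
    have h1 : (A.submatrix id (f ∘ π)).det =
        ((Equiv.Perm.sign π : ℤ) : MvPolynomial ι ℝ) * (A.submatrix id f).det := by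
      rw [← Matrix.det_permute']
      rfl
    have h2 : (B.submatrix (f ∘ π) id).det =
        ((Equiv.Perm.sign π : ℤ) : MvPolynomial ι ℝ) * (B.submatrix f id).det := by
      rw [← Matrix.det_permute]
      rfl
    have h3 : (A.submatrix id f).det * (B.submatrix f id).det =
        (A.submatrix id (f ∘ π)).det * (B.submatrix (f ∘ π) id).det := by
      rw [h1, h2, mul_mul_mul_comm, ← Int.cast_mul, ← Units.val_mul, Int.units_mul_self]
      simp
    rw [h3]
    exact mul_mem (hA _ hg) (hB _ hg)
  · obtain ⟨i, j, hij, hne⟩ := Function.not_injective_iff.mp hf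
    rw [Matrix.det_zero_of_row_eq hne (M := B.submatrix f id) (by ext l; simp [hij]), mul_zero]
    exact zero_mem _

section Lower

variable {ι : Type*}

theorem isTotallyPositive_iff {m n : Type*} [LinearOrder m] [LinearOrder n]
    {M : Matrix m n (MvPolynomial ι ℝ)} :
    IsTotallyPositive M ↔ ∀ (k : ℕ) (rows : Fin k → m) (cols : Fin k → n),
      StrictMono rows → StrictMono cols → CoeffNonneg (M.submatrix rows cols).det := by
  refine ⟨fun h k rows cols hr hc => ?_, fun h r _ k _ _ rows cols hr hc => h k rows cols hr hc⟩
  rcases Nat.eq_zero_or_pos k with rfl | hk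
  · rw [Matrix.det_isEmpty]
    exact one_mem (coeffNonnegSubsemiring ι)
  · exact h k hk k hk le_rfl rows cols hr hc

/-- A minor of the product `C` of a lower triangular matrix `A` and a totally positive matrix `B`
has nonnegative coefficients as soon as the minors of `A` in the same rows do. -/
theorem coeffNonneg_minor_of_lower_mul {A B C : Matrix ℕ ℕ (MvPolynomial ι ℝ)}
    (hA : ∀ i j, i < j → A i j = 0) (hB : IsTotallyPositive B)
    (hC : ∀ i j, C i j = ∑ l ∈ range (i + 1), A i l * B l j) {k : ℕ} {rows cols : Fin k → ℕ}
    (hcols : StrictMono cols)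
    (h : ∀ g : Fin k → ℕ, StrictMono g → CoeffNonneg (A.submatrix rows g).det) :
    CoeffNonneg (C.submatrix rows cols).det := by
  -- The rows are finitely many, so only finitely many columns of `A` matter.
  obtain ⟨N, hN⟩ : ∃ N, ∀ t, rows t < N :=
    ⟨univ.sup rows + 1, fun t => Nat.lt_succ_of_le (le_sup (f := rows) (mem_univ t))⟩
  have hmul : C.submatrix rows cols =
      A.submatrix rows (Fin.val : Fin N → ℕ) * B.submatrix (Fin.val : Fin N → ℕ) cols := by
    ext1 s t
    simp only [Matrix.submatrix_apply, Matrix.mul_apply]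
    rw [Fin.sum_univ_eq_sum_range (fun l => A (rows s) l * B l (cols t)), hC]
    refine sum_subset (range_subset_range.mpr (hN s)) fun l _ hl => ?_
    rw [hA _ _ (by simpa using hl), zero_mul]
  rw [hmul]
  exact coeffNonneg_det_mul (fun g hg => h _ (Fin.val_strictMono.comp hg))
    fun g hg => isTotallyPositive_iff.mp hB k _ _ (Fin.val_strictMono.comp hg) hcols

/-- Laplace expansion along a first row or a first column that vanishes off the corner. -/
theorem det_eq_corner_mul {R : Type*} [CommRing R] {k : ℕ}
    (M : Matrix (Fin (k + 1)) (Fin (k + 1)) R)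
    (h : (∀ j : Fin k, M 0 j.succ = 0) ∨ ∀ i : Fin k, M i.succ 0 = 0) :
    M.det = M 0 0 * (M.submatrix Fin.succ Fin.succ).det := by
  rcases h with h | h
  · rw [Matrix.det_succ_row_zero, Fin.sum_univ_succ]
    simp [h]
  · rw [Matrix.det_succ_column_zero, Fin.sum_univ_succ]
    simp [h]

/-- The lower bidiagonal matrix with `1` on the diagonal and `c, 2 c, 3 c, …` below it. -/
noncomputable def lowerBidiagonal (c : MvPolynomial ι ℝ) : Matrix ℕ ℕ (MvPolynomial ι ℝ) :=
  Matrix.of fun i j => if i = j then 1 else if i = j + 1 then ((j + 1 : ℕ) : MvPolynomial ι ℝ) * c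
    else 0

theorem isTotallyPositive_lowerBidiagonal {c : MvPolynomial ι ℝ} (hc : CoeffNonneg c) :
    IsTotallyPositive (lowerBidiagonal c) := by
  rw [isTotallyPositive_iff]
  intro k
  induction k with
  | zero =>
    intro rows cols _ _
    rw [Matrix.det_isEmpty]
    exact one_mem (coeffNonnegSubsemiring ι)
  | succ k ih =>
    intro rows cols hr hcol
    rw [det_eq_corner_mul]
    · refine (coeffNonnegSubsemiring ι).mul_mem ?_
        (ih (rows ∘ Fin.succ) (cols ∘ Fin.succ) (hr.comp (Fin.strictMono_succ))
          (hcol.comp (Fin.strictMono_succ)))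
      simp only [Matrix.submatrix_apply, lowerBidiagonal, Matrix.of_apply]
      split_ifs
      · exact one_mem _
      · exact mul_mem (natCast_mem _ _) hc
      · exact zero_mem _
    · -- The first row vanishes to the right of the corner if the corner lies on or above the
      -- diagonal, and the first column vanishes below the corner otherwise.
      rcases le_or_gt (rows 0) (cols 0) with h | h
      · left
        intro j
        have := hcol (Fin.succ_pos j)
        simp only [Matrix.submatrix_apply, lowerBidiagonal, Matrix.of_apply]
        rw [if_neg (by omega), if_neg (by omega)]
      · right
        intro i
        have := hr (Fin.succ_pos i)
        simp only [Matrix.submatrix_apply, lowerBidiagonal, Matrix.of_apply]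
        rw [if_neg (by omega), if_neg (by omega)]

/-- Right multiplication by `lowerBidiagonal c` preserves the nonnegativity of the minors in any
given rows. -/
theorem coeffNonneg_minor_mul_lowerBidiagonal {A C : Matrix ℕ ℕ (MvPolynomial ι ℝ)}
    {c : MvPolynomial ι ℝ} (hc : CoeffNonneg c) (hA : ∀ i j, i < j → A i j = 0)
    (hC : ∀ i j, C i j = A i j + A i (j + 1) * (((j + 1 : ℕ) : MvPolynomial ι ℝ) * c))
    {k : ℕ} {rows cols : Fin k → ℕ} (hcols : StrictMono cols)
    (h : ∀ g : Fin k → ℕ, StrictMono g → CoeffNonneg (A.submatrix rows g).det) :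
    CoeffNonneg (C.submatrix rows cols).det := by
  refine coeffNonneg_minor_of_lower_mul hA (isTotallyPositive_lowerBidiagonal hc)
    (fun i j => ?_) hcols h
  have hsum : ∑ l ∈ range (i + 1), A i l * lowerBidiagonal c l j =
      ∑ l ∈ range (i + j + 2), A i l * lowerBidiagonal c l j := by
    refine sum_subset (range_subset_range.mpr (by omega)) fun l _ hl => ?_
    rw [hA _ _ (by simpa using hl), zero_mul]
  have hpair : ∑ l ∈ range (i + j + 2), A i l * lowerBidiagonal c l j =
      ∑ l ∈ {j, j + 1}, A i l * lowerBidiagonal c l j := by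
    symm
    refine sum_subset (fun l hl => ?_) fun l _ hl => ?_
    · simp only [mem_insert, mem_singleton] at hl
      simp only [mem_range]
      omega
    · simp only [mem_insert, mem_singleton, not_or] at hl
      simp [lowerBidiagonal, hl.1, hl.2]
  rw [hsum, hpair, sum_pair (by omega), hC]
  simp [lowerBidiagonal]

/-- The block diagonal matrix with blocks `1` and `A`. -/
def borderOne {R : Type*} [Zero R] [One R] (A : Matrix ℕ ℕ R) : Matrix ℕ ℕ R
  | 0, 0 => 1
  | 0, _ + 1 => 0
  | _ + 1, 0 => 0
  | i + 1, j + 1 => A i j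

/-- The minors of `borderOne A` in the rows below `N + 1` have nonnegative coefficients if those of
`A` in the rows below `N` do: a minor that meets the first row or the first column is zero or loses
that row and that column. -/
theorem coeffNonneg_minor_borderOne {A : Matrix ℕ ℕ (MvPolynomial ι ℝ)} {N : ℕ}
    (hA : ∀ (k : ℕ) (rows cols : Fin k → ℕ), StrictMono rows → StrictMono cols →
      (∀ t, rows t < N) → CoeffNonneg (A.submatrix rows cols).det)
    {k : ℕ} {rows cols : Fin k → ℕ} (hr : StrictMono rows) (hc : StrictMono cols)
    (hN : ∀ t, rows t < N + 1) : CoeffNonneg ((borderOne A).submatrix rows cols).det := by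
  have hpos : ∀ (k : ℕ) (rows cols : Fin k → ℕ), StrictMono rows → StrictMono cols →
      (∀ t, rows t < N + 1) → (∀ t, 0 < rows t) → (∀ t, 0 < cols t) →
      CoeffNonneg ((borderOne A).submatrix rows cols).det := by
    intro k rows cols hr hc hN hr0 hc0
    have heq : (borderOne A).submatrix rows cols =
        A.submatrix (fun t => rows t - 1) (fun t => cols t - 1) := by
      ext1 s t
      obtain ⟨a, ha⟩ := Nat.exists_eq_add_of_lt (hr0 s)
      obtain ⟨b, hb⟩ := Nat.exists_eq_add_of_lt (hc0 t)
      simp only [Matrix.submatrix_apply, ha, hb, zero_add, Nat.add_sub_cancel]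
      rfl
    rw [heq]
    refine hA k _ _ (fun s t hst => ?_) (fun s t hst => ?_) fun t => ?_
    · have := hr hst
      have := hr0 s
      omega
    · have := hc hst
      have := hc0 s
      omega
    · have := hN t
      have := hr0 t
      omega
  rcases k with _ | k
  · rw [Matrix.det_isEmpty]
    exact one_mem (coeffNonnegSubsemiring ι)
  have hrs : ∀ t : Fin k, 0 < rows t.succ := fun t => (Nat.zero_le _).trans_lt (hr t.succ_pos)
  have hcs : ∀ t : Fin k, 0 < cols t.succ := fun t => (Nat.zero_le _).trans_lt (hc t.succ_pos)
  by_cases h : 0 < rows 0 ∧ 0 < cols 0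
  · exact hpos _ _ _ hr hc hN (Fin.cases h.1 hrs) (Fin.cases h.2 hcs)
  · have hrow : ∀ j, 0 < j → borderOne A 0 j = 0 := by
      rintro (_ | j) hj
      · exact absurd hj (lt_irrefl _)
      · rfl
    have hcol : ∀ i, 0 < i → borderOne A i 0 = 0 := by
      rintro (_ | i) hi
      · exact absurd hi (lt_irrefl _)
      · rfl
    have hor : rows 0 = 0 ∨ cols 0 = 0 := by omega
    rw [det_eq_corner_mul]
    · refine (coeffNonnegSubsemiring ι).mul_mem ?_
        (hpos k (rows ∘ Fin.succ) (cols ∘ Fin.succ) (hr.comp Fin.strictMono_succ)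
          (hc.comp Fin.strictMono_succ) (fun t => hN _) hrs hcs)
      simp only [Matrix.submatrix_apply]
      rcases Nat.eq_zero_or_pos (rows 0) with h1 | h1 <;>
        rcases Nat.eq_zero_or_pos (cols 0) with h2 | h2
      · rw [h1, h2]
        exact one_mem _
      · rw [h1, hrow _ h2]
        exact zero_mem _
      · rw [h2, hcol _ h1]
        exact zero_mem _
      · omega
    · rcases hor with h0 | h0
      · left
        intro j
        rw [Matrix.submatrix_apply, h0, hrow _ (hcs j)]
      · right
        intro i
        rw [Matrix.submatrix_apply, h0, hcol _ (hrs i)]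

end Lower

/-! ### The recurrence for the Eulerian polynomials -/

section Words

variable {R : Type*} [CommRing R]

/-- The weight of the word `w`: a factor `p` for each rise and a factor `q` for each other pair of
adjacent letters. -/
def wordWeight (p q : R) {n : ℕ} (w : Fin (n + 1) → ℕ) : R :=
  ∏ i : Fin n, if w i.castSucc < w i.succ then p else q

theorem wordWeight_cons (p q : R) {n : ℕ} (a : ℕ) (w : Fin (n + 1) → ℕ) :
    wordWeight p q (Fin.cons a w : Fin (n + 2) → ℕ) =
      (if a < w 0 then p else q) * wordWeight p q w := by
  unfold wordWeight
  rw [Fin.prod_univ_succ]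
  rfl

/-- Inserting a new largest letter `m` into a word in all possible ways: at the left end it makes
a descent, at the right end a rise, and between two adjacent letters it replaces their factor,
whether `p` or `q`, by `p * q`. This last effect is that of a derivation `D` with
`D p = D q = p * q`. -/
theorem sum_wordWeight_insertNth {A : Type*} [CommSemiring A] [Algebra A R] (D : Derivation A R R)
    {p q : R} (hp : D p = p * q) (hq : D q = p * q) {n m : ℕ} (w : Fin (n + 1) → ℕ)
    (hw : ∀ i, w i < m) :
    ∑ j : Fin (n + 2), wordWeight p q (Fin.insertNth j m w : Fin (n + 2) → ℕ) =
      (p + q) * wordWeight p q w + D (wordWeight p q w) := by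
  induction n with
  | zero =>
    have h1 : wordWeight p q w = 1 := by simp [wordWeight]
    have h2 : (Fin.insertNth 1 m w : Fin 2 → ℕ) 0 = w 0 :=
      Fin.insertNth_apply_succAbove (α := fun _ => ℕ) 1 m w 0
    rw [Fin.sum_univ_two, h1]
    simp [wordWeight, h2, hw 0, (hw 0).not_gt, add_comm]
  | succ n ih =>
    obtain ⟨a, v, rfl⟩ : ∃ (a : ℕ) (v : Fin (n + 1) → ℕ), w = Fin.cons a v :=
      ⟨w 0, Fin.tail w, (Fin.cons_self_tail w).symm⟩
    have ha : a < m := hw 0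
    have hv : ∀ i, v i < m := fun i => hw i.succ
    have hih := ih v hv
    rw [Fin.sum_univ_succ, Fin.insertNth_zero'] at hih ⊢
    rw [Fin.sum_univ_succ (n := n + 1)]
    simp only [Fin.insertNth_succ_cons]
    rw [Fin.insertNth_zero']
    simp only [wordWeight_cons, Fin.cons_zero, if_pos ha, if_neg ha.not_gt,
      if_neg (hv 0).not_gt] at hih ⊢
    have hsucc : ∀ j : Fin (n + 1), (Fin.insertNth j.succ m v : Fin (n + 2) → ℕ) 0 = v 0 := by
      intro j
      have := Fin.insertNth_apply_succAbove (α := fun _ => ℕ) j.succ m v 0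
      rwa [Fin.succ_succAbove_zero] at this
    simp only [hsucc]
    rw [← mul_sum, Derivation.leibniz]
    have hx : D (if a < v 0 then p else q) = p * q := by
      split_ifs
      · exact hp
      · exact hq
    rw [hx]
    generalize (if a < v 0 then p else q) = x at *
    simp only [smul_eq_mul]
    generalize wordWeight p q v = W at *
    linear_combination x * hih

end Words

/-- The permutation of `n + 1` letters whose word is that of the permutation `x.2` of `n` letters
with a new largest letter inserted in position `x.1`. -/
def insertLargest {n : ℕ} (x : Fin (n + 1) × Equiv.Perm (Fin n)) : Equiv.Perm (Fin (n + 1)) :=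
  (finSuccEquiv' x.1).trans ((Equiv.optionCongr x.2).trans (finSuccEquiv' (Fin.last n)).symm)

theorem insertLargest_self {n : ℕ} (j : Fin (n + 1)) (τ : Equiv.Perm (Fin n)) :
    insertLargest (j, τ) j = Fin.last n := by
  simp [insertLargest]

theorem insertLargest_succAbove {n : ℕ} (j : Fin (n + 1)) (τ : Equiv.Perm (Fin n)) (i : Fin n) :
    insertLargest (j, τ) (j.succAbove i) = (τ i).castSucc := by
  simp [insertLargest]

theorem insertLargest_bijective (n : ℕ) :
    Function.Bijective (insertLargest : Fin (n + 1) × Equiv.Perm (Fin n) → _) := by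
  rw [Fintype.bijective_iff_injective_and_card]
  refine ⟨?_, by simp [Fintype.card_perm, Nat.factorial_succ]⟩
  rintro ⟨j, τ⟩ ⟨j', τ'⟩ h
  obtain rfl : j = j' := (insertLargest (j, τ)).injective <| by
    rw [insertLargest_self, h, insertLargest_self]
  refine Prod.ext rfl (Equiv.ext fun i => Fin.castSucc_injective n ?_)
  rw [← insertLargest_succAbove j, h, insertLargest_succAbove]

theorem coe_insertLargest {n : ℕ} (j : Fin (n + 1)) (τ : Equiv.Perm (Fin n)) :
    (fun i => (insertLargest (j, τ) i : ℕ)) = Fin.insertNth j n (fun i => (τ i : ℕ)) := by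
  rw [Fin.eq_insertNth_iff]
  refine ⟨by simp [insertLargest_self], ?_⟩
  funext i
  simp [Fin.removeNth, insertLargest_succAbove]

theorem pow_ris_mul_pow_des {R : Type*} [CommRing R] (p q : R) {n : ℕ}
    (σ : Equiv.Perm (Fin (n + 1))) :
    p ^ ris σ * q ^ des σ = wordWeight p q (fun i => (σ i : ℕ)) := by
  have hris : ris σ = #{i : Fin n | (σ i.castSucc : ℕ) < σ i.succ} := by
    rw [ris, card_filter, Fin.sum_univ_castSucc, card_filter]
    simp [Fin.succ]
  have hdes : des σ = #{i : Fin n | ¬ (σ i.castSucc : ℕ) < σ i.succ} := by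
    rw [des, card_filter, Fin.sum_univ_castSucc, card_filter]
    have hne : ∀ i : Fin n, σ i.succ < σ i.castSucc ↔ ¬ σ i.castSucc < σ i.succ := fun i => by
      rw [not_lt, le_iff_lt_or_eq, σ.injective.eq_iff]
      simp [(Fin.castSucc_lt_succ (i := i)).ne']
    simp only [Fin.val_fin_lt, ← hne]
    simp [Fin.succ]
  rw [wordWeight, prod_ite, prod_const, prod_const, hris, hdes]

theorem eulerianPoly_succ_eq_sum (n : ℕ) :
    eulerianPoly (n + 1) =
      ∑ σ : Equiv.Perm (Fin (n + 1)), wordWeight (X 0) (X 1) (fun i => (σ i : ℕ)) :=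
  sum_congr rfl fun σ _ => pow_ris_mul_pow_des _ _ σ

/-- The derivation `∂/∂p + ∂/∂q`. -/
noncomputable def pderivSum :
    Derivation ℝ (MvPolynomial (Fin 2) ℝ) (MvPolynomial (Fin 2) ℝ) :=
  pderiv 0 + pderiv 1

theorem pderivSum_X_zero : pderivSum (X 0) = 1 := by
  simp [pderivSum, pderiv_X]

theorem pderivSum_X_one : pderivSum (X 1) = 1 := by
  simp [pderivSum, pderiv_X]

theorem eulerianPoly_one : eulerianPoly 1 = 1 := by
  simp [eulerianPoly_succ_eq_sum, wordWeight]

theorem eulerianPoly_add_two (n : ℕ) :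
    eulerianPoly (n + 2) = (X 0 + X 1) * eulerianPoly (n + 1) +
      X 0 * X 1 * pderivSum (eulerianPoly (n + 1)) := by
  rw [eulerianPoly_succ_eq_sum (n + 1), ← (insertLargest_bijective (n + 1)).sum_comp,
    Fintype.sum_prod_type_right, eulerianPoly_succ_eq_sum, mul_sum, map_sum, mul_sum,
    ← sum_add_distrib]
  refine sum_congr rfl fun τ _ => ?_
  simp only [coe_insertLargest]
  exact sum_wordWeight_insertNth
    ((X 0 * X 1 : MvPolynomial (Fin 2) ℝ) • pderivSum)
    (by simp [pderivSum_X_zero]) (by simp [pderivSum_X_one]) _ fun i => (τ i).isLt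

/-! ### The Stieltjes matrix of the Eulerian polynomials -/

/-- The Stieltjes matrix of the Eulerian polynomials: the lower triangular matrix whose row `0` is
that of the identity and in which each row is the preceding one multiplied by the tridiagonal
matrix with diagonal entries `(k + 1) (p + q)`, entries `1` above the diagonal and
`(k + 1) (k + 2) p q` below it. -/
noncomputable def stieltjesMatrix : Matrix ℕ ℕ (MvPolynomial (Fin 2) ℝ)
  | 0, 0 => 1
  | 0, _ + 1 => 0
  | n + 1, 0 => (X 0 + X 1) * stieltjesMatrix n 0 + 2 * (X 0 * X 1) * stieltjesMatrix n 1
  | n + 1, k + 1 => stieltjesMatrix n k +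
      ((k : MvPolynomial (Fin 2) ℝ) + 2) * (X 0 + X 1) * stieltjesMatrix n (k + 1) +
      ((k : MvPolynomial (Fin 2) ℝ) + 2) * ((k : MvPolynomial (Fin 2) ℝ) + 3) * (X 0 * X 1) *
        stieltjesMatrix n (k + 2)

theorem stieltjesMatrix_eq_zero {i j : ℕ} (h : i < j) : stieltjesMatrix i j = 0 := by
  induction i generalizing j with
  | zero =>
    obtain ⟨j, rfl⟩ := Nat.exists_eq_add_of_lt h
    rw [zero_add, stieltjesMatrix]
  | succ i ih =>
    rcases j with _ | j
    · omega
    · simp only [stieltjesMatrix, ih (show i < j by omega), ih (show i < j + 1 by omega),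
        ih (show i < j + 2 by omega)]
      ring

/-- Iterates of `∂/∂p + ∂/∂q` on the recurrence of the Eulerian polynomials. -/
theorem iterate_pderivSum (f : MvPolynomial (Fin 2) ℝ) (k : ℕ) :
    pderivSum^[k + 1] ((X 0 + X 1) * f + X 0 * X 1 * pderivSum f) =
      ((k : MvPolynomial (Fin 2) ℝ) + 1) * ((k : MvPolynomial (Fin 2) ℝ) + 2) * pderivSum^[k] f +
        ((k : MvPolynomial (Fin 2) ℝ) + 2) * (X 0 + X 1) * pderivSum^[k + 1] f +
        X 0 * X 1 * pderivSum^[k + 2] f := by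
  induction k with
  | zero =>
    simp only [Function.iterate_succ', Function.iterate_zero, Function.comp_apply, id,
      map_add, Derivation.leibniz, smul_eq_mul, pderivSum_X_zero, pderivSum_X_one]
    push_cast
    ring
  | succ k ih =>
    rw [Function.iterate_succ_apply', ih]
    have hc : ∀ m : ℕ, pderivSum (m : MvPolynomial (Fin 2) ℝ) = 0 := fun m =>
      Derivation.map_natCast _ _
    have h1 : pderivSum 1 = 0 := Derivation.map_one_eq_zero _
    have h2 : pderivSum 2 = 0 := by exact_mod_cast hc 2
    rw [Function.iterate_succ_apply' _ (k + 2), Function.iterate_succ_apply' _ (k + 1),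
      Function.iterate_succ_apply' _ k]
    simp only [map_add, Derivation.leibniz, smul_eq_mul, pderivSum_X_zero, pderivSum_X_one, hc, h1, h2]
    push_cast
    ring

/-- The entries of the Stieltjes matrix are the Taylor coefficients of the Eulerian polynomials
along `∂/∂p + ∂/∂q`, up to a factor `(k + 1)!`. -/
theorem factorial_mul_stieltjesMatrix (n k : ℕ) :
    ((k.factorial * (k + 1).factorial : ℕ) : MvPolynomial (Fin 2) ℝ) * stieltjesMatrix n k =
      pderivSum^[k] (eulerianPoly (n + 1)) := by
  induction n generalizing k with
  | zero =>
    rw [eulerianPoly_one]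
    rcases k with _ | k
    · simp [stieltjesMatrix]
    · rw [Function.iterate_succ_apply, Derivation.map_one_eq_zero, iterate_map_zero]
      simp [stieltjesMatrix]
  | succ n ih =>
    rw [eulerianPoly_add_two]
    rcases k with _ | k
    · have h0 := ih 0
      have h1 := ih 1
      simp only [Function.iterate_succ_apply', Function.iterate_zero, id] at h0 h1 ⊢
      rw [← h1, ← h0]
      simp [stieltjesMatrix, Nat.factorial]
      ring
    · rw [iterate_pderivSum, ← ih k, ← ih (k + 1), ← ih (k + 2)]
      simp only [stieltjesMatrix, Nat.factorial_succ]
      push_cast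
      ring

theorem stieltjesMatrix_zero_right (n : ℕ) : stieltjesMatrix n 0 = eulerianPoly (n + 1) := by
  simpa using factorial_mul_stieltjesMatrix n 0

/-- The weights `k! (k + 1)! (p q) ^ k` that symmetrize the tridiagonal recurrence of
`stieltjesMatrix`. -/
noncomputable def hankelWeight (k : ℕ) : MvPolynomial (Fin 2) ℝ :=
  ((k.factorial * (k + 1).factorial : ℕ) : MvPolynomial (Fin 2) ℝ) * (X 0 * X 1) ^ k

theorem hankelWeight_succ (k : ℕ) :
    hankelWeight (k + 1) =
      ((k : MvPolynomial (Fin 2) ℝ) + 1) * ((k : MvPolynomial (Fin 2) ℝ) + 2) *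
        (X 0 * X 1) * hankelWeight k := by
  simp only [hankelWeight, Nat.factorial_succ]
  push_cast
  ring

/-- A Christoffel–Darboux identity: the tridiagonal recurrence is symmetric for the weights
`hankelWeight`, up to a boundary term. -/
theorem sum_hankelWeight_mul_sub (i j n : ℕ) :
    ∑ l ∈ range (n + 1), (stieltjesMatrix (i + 1) l * (hankelWeight l * stieltjesMatrix j l) -
      stieltjesMatrix i l * (hankelWeight l * stieltjesMatrix (j + 1) l)) =
    hankelWeight (n + 1) * (stieltjesMatrix i (n + 1) * stieltjesMatrix j n -
      stieltjesMatrix i n * stieltjesMatrix j (n + 1)) := by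
  induction n with
  | zero =>
    simp only [zero_add, sum_range_one, stieltjesMatrix]
    simp only [hankelWeight, Nat.factorial]
    push_cast
    ring
  | succ n ih =>
    rw [sum_range_succ, ih, hankelWeight_succ (n + 1)]
    simp only [stieltjesMatrix]
    push_cast
    ring

/-- The Hankel matrix of the Eulerian polynomials is `S W Sᵀ` with `S` the Stieltjes matrix and `W`
the diagonal matrix of the weights. -/
theorem eulerianPoly_add_eq_sum {N : ℕ} (i j : ℕ) (h : i + j < N) :
    eulerianPoly (i + j + 1) =
      ∑ l ∈ range N, stieltjesMatrix i l * (hankelWeight l * stieltjesMatrix j l) := by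
  induction j generalizing i with
  | zero =>
    rw [sum_eq_single_of_mem 0 (by simp; omega)]
    · simp [stieltjesMatrix_zero_right, hankelWeight, eulerianPoly_one]
    · intro l _ hl
      rw [stieltjesMatrix_eq_zero (Nat.pos_of_ne_zero hl), mul_zero, mul_zero]
  | succ j ih =>
    obtain ⟨n, rfl⟩ := Nat.exists_eq_add_of_lt h
    have hcd := sum_hankelWeight_mul_sub i j (i + (j + 1) + n)
    rw [stieltjesMatrix_eq_zero (show i < i + (j + 1) + n + 1 by omega),
      stieltjesMatrix_eq_zero (show j < i + (j + 1) + n + 1 by omega), mul_zero, zero_mul,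
      sub_zero, mul_zero, sum_sub_distrib, sub_eq_zero] at hcd
    rw [← hcd, ← ih (i + 1) (by omega)]
    congr 1
    omega

/-! ### Total positivity -/

/-- One step of the recurrence of `stieltjesMatrix`, factored: the tridiagonal matrix, bordered by
the first row of the identity, is `lowerBidiagonal p * lowerBidiagonal q`. -/
theorem stieltjesMatrix_eq_borderOne (i j : ℕ) :
    stieltjesMatrix i j =
      (borderOne stieltjesMatrix i j +
        borderOne stieltjesMatrix i (j + 1) * (((j + 1 : ℕ) : MvPolynomial (Fin 2) ℝ) * X 0)) +
      (borderOne stieltjesMatrix i (j + 1) +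
        borderOne stieltjesMatrix i (j + 2) * (((j + 2 : ℕ) : MvPolynomial (Fin 2) ℝ) * X 0)) *
        (((j + 1 : ℕ) : MvPolynomial (Fin 2) ℝ) * X 1) := by
  rcases i with _ | i <;> rcases j with _ | j <;> simp only [borderOne, stieltjesMatrix] <;>
    push_cast <;> ring

theorem borderOne_eq_zero {R : Type*} [Zero R] [One R] {A : Matrix ℕ ℕ R}
    (hA : ∀ i j, i < j → A i j = 0) {i j : ℕ} (h : i < j) : borderOne A i j = 0 := by
  rcases i with _ | i <;> rcases j with _ | j
  · omega
  · rfl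
  · rfl
  · exact hA i j (by omega)

theorem isTotallyPositive_stieltjesMatrix : IsTotallyPositive stieltjesMatrix := by
  have main : ∀ (N k : ℕ) (rows cols : Fin k → ℕ), StrictMono rows → StrictMono cols →
      (∀ t, rows t < N) → CoeffNonneg (stieltjesMatrix.submatrix rows cols).det := by
    intro N
    induction N with
    | zero =>
      intro k rows cols _ _ hN
      rcases k with _ | k
      · rw [Matrix.det_isEmpty]
        exact one_mem (coeffNonnegSubsemiring (Fin 2))
      · exact absurd (hN 0) (Nat.not_lt_zero _)
    | succ N ih =>
      intro k rows cols hr hc hN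
      have hlow : ∀ i j, i < j → borderOne stieltjesMatrix i j = 0 := fun i j =>
        borderOne_eq_zero fun _ _ => stieltjesMatrix_eq_zero
      obtain ⟨Q, hQ⟩ : ∃ Q : Matrix ℕ ℕ (MvPolynomial (Fin 2) ℝ), ∀ i j,
          Q i j = borderOne stieltjesMatrix i j + borderOne stieltjesMatrix i (j + 1) *
            (((j + 1 : ℕ) : MvPolynomial (Fin 2) ℝ) * X 0) := ⟨fun i j => _, fun _ _ => rfl⟩
      have hQlow : ∀ i j, i < j → Q i j = 0 := fun i j hij => by
        rw [hQ, hlow _ _ hij, hlow _ _ (by omega), zero_mul, add_zero]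
      refine coeffNonneg_minor_mul_lowerBidiagonal (coeffNonneg_X 1) hQlow (fun i j => ?_) hc
        fun g hg => coeffNonneg_minor_mul_lowerBidiagonal (coeffNonneg_X 0) hlow hQ hg
          fun g' hg' => coeffNonneg_minor_borderOne ih hr hg' hN
      rw [hQ, hQ]
      exact stieltjesMatrix_eq_borderOne i j
  rw [isTotallyPositive_iff]
  exact fun k rows cols hr hc => main (univ.sup rows + 1) k rows cols hr hc fun t =>
    Nat.lt_succ_of_le (le_sup (f := rows) (mem_univ t))

theorem coeffNonneg_hankelWeight (k : ℕ) : CoeffNonneg (hankelWeight k) :=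
  (coeffNonnegSubsemiring (Fin 2)).mul_mem (natCast_mem _ _)
    (pow_mem (mul_mem (coeffNonneg_X 0) (coeffNonneg_X 1)) _)

theorem isTotallyPositive_hankelWeight_mul_transpose :
    IsTotallyPositive
      (Matrix.of fun l j => hankelWeight l * stieltjesMatrix j l : Matrix ℕ ℕ _) := by
  rw [isTotallyPositive_iff]
  intro k rows cols hr hc
  have hdet := Matrix.det_mul_column (fun s => hankelWeight (rows s))
    (stieltjesMatrix.submatrix cols rows).transpose
  rw [Matrix.det_transpose] at hdet
  refine Eq.subst (motive := CoeffNonneg) hdet.symm ?_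
  exact (coeffNonnegSubsemiring (Fin 2)).mul_mem
    (prod_mem fun s _ => coeffNonneg_hankelWeight _)
    (isTotallyPositive_iff.mp isTotallyPositive_stieltjesMatrix k _ _ hc hr)

end StieltjesPoly

theorem mainTheorem12 :
    StieltjesPoly.IsStieltjesMomentSequence
      (fun k : ℕ => StieltjesPoly.eulerianPoly (k + 1)) := by
  refine StieltjesPoly.isTotallyPositive_iff.mpr fun k rows cols hr hc => ?_
  refine StieltjesPoly.coeffNonneg_minor_of_lower_mul
    (fun i j => StieltjesPoly.stieltjesMatrix_eq_zero)
    StieltjesPoly.isTotallyPositive_hankelWeight_mul_transpose (fun i j => ?_) hc fun g hg =>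
      StieltjesPoly.isTotallyPositive_iff.mp StieltjesPoly.isTotallyPositive_stieltjesMatrix
        k _ _ hr hg
  refine (StieltjesPoly.eulerianPoly_add_eq_sum i j (lt_add_one (i + j))).trans (Eq.symm ?_)
  refine Finset.sum_subset (Finset.range_subset_range.mpr (by omega)) fun l _ hl => ?_
  rw [StieltjesPoly.stieltjesMatrix_eq_zero (by simpa using hl), zero_mul]
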